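/- Let $d\ge 2$, and let $F$ and $G$ be probability distributions on $\mathbb R^d$ having everywhere positive Lebesgue densities that are bounded on every bounded subset of $\mathbb R^d$. Let $\mathbf x_1,\mathbf x_2,\dots$ be i.i.d. from $F$ and $\mathbf y_1,\mathbf y_2,\dots$ i.i.d. from $G$, the two sequences being independent, and put $\mathcal X=\{\mathbf x_1,\dots,\mathbf x_n\}$, $\mathcal Y=\{\mathbf y_1,\dots,\mathbf y_m\}$. For $\mathbf u\in\mathbb R^d$ with $\|\mathbf u\|<1$ let $\Phi(\mathbf u,\mathbf s)=\|\mathbf s\|+\langle\mathbf u,\mathbf s\rangle$ (Euclidean norm and inner product). The empirical spatial quantile $Q_{\mathcal X}(\mathbf u)=(Q_{\mathcal X,1}(\mathbf u),\dots,Q_{\mathcal X,d}(\mathbf u))$ is $$Q_{\mathcal X}(\mathbf u)=\arg\min_{Q\in\mathbb R^d}\ \frac1n\sum_{j=1}^n\{\Phi(\mathbf u,\mathbf x_j-Q)-\Phi(\mathbf u,\mathbf x_j)\}$$ (a fixed choice of minimizer in the case of non-uniqueness, which has probability zero when $n\ge3$), and $Q_{\mathcal Y}(\mathbf u)$ is defined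 likewise from $\mathcal Y$. The spatial rank of $\mathbf z\in\mathbb R^d$ with respect to $\mathcal X$ is $n^{-1}\sum_{j:\mathbf x_j\ne\mathbf z}\|\mathbf z-\mathbf x_j\|^{-1}(\mathbf z-\mathbf x_j)$, and likewise for $\mathcal Y$. Let $\mathbf u_1,\dots,\mathbf u_n$ be the spatial ranks of $\mathbf x_1,\dots,\mathbf x_n$ with respect to $\mathcal X$, and let $\mathbf u_{n+1},\dots,\mathbf u_{n+m}$ be the spatial ranks of $\mathbf y_1,\dots,\mathbf y_m$ with respect to $\mathcal Y$. For $r\in(0,1)$ and $i=1,\dots,d$ let $$S^{(r)}_{n,m,i}(\mathcal X,\mathcal Y)=\{(Q_{\mathcal X,i}(\mathbf u_k),Q_{\mathcal Y,i}(\mathbf u_k)):\ 1\le k\le n+m,\ \|\mathbf u_k\|\le r\}\subset\mathbb R^2,$$ and for $\varepsilon>0$ let $L(\varepsilon)$ be the set of points of $\mathbb R^2$ at Euclidean distance less than $\varepsilon$ from the line with slope $1$ and intercept $0$. Let $n=n_N$ and $m=m_N$ tend to infinity, as $N\to\infty$, in such a way that $n/(n+m)\to\lambda\in(0,1)$. Then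 $$\lim_{N\to\infty}P\Bigl(\bigcap_{i=1}^d\bigl[S^{(r)}_{n,m,i}(\mathcal X,\mathcal Y)\subseteq L(\varepsilon)\bigr]\Bigr)=1\qquad\text{for every } r\in(0,1)\text{ and every }\varepsilon>0$$ if and only if $F=G$. -/

import Mathlib

open MeasureTheory ProbabilityTheory Filter Topology

noncomputable section

/-- `Φ(u, s) = ‖s‖ + ⟪u, s⟫` on `ℝ^d` with the Euclidean structure. -/
def quantileLoss {d : ℕ} (u s : EuclideanSpace ℝ (Fin d)) : ℝ :=
  ‖s‖ + inner ℝ u s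

/-- The objective `Q ↦ E {Φ(u, x - Q) - Φ(u, x)}`, where `x` has distribution `F`. -/
def quantileObjective {d : ℕ} (F : Measure (EuclideanSpace ℝ (Fin d)))
    (u Q : EuclideanSpace ℝ (Fin d)) : ℝ :=
  ∫ x, (quantileLoss u (x - Q) - quantileLoss u x) ∂F

/-- `q` minimizes the objective over the whole of `ℝ^d`. -/
def IsSpatialQuantile {d : ℕ} (F : Measure (EuclideanSpace ℝ (Fin d)))
    (u q : EuclideanSpace ℝ (Fin d)) : Prop :=
  ∀ Q, quantileObjective F u q ≤ quantileObjective F u Q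

/-- The spatial quantile `Q_F(u)`, the arg min of the objective. For `‖u‖ < 1` and a
probability measure `F` a minimizer exists, and it is unique unless `F` is carried by a line
(in particular it is almost surely unique for samples of size at least three from a
distribution with a density, `d ≥ 2`); on a line with ties, this is one fixed minimizer. -/
def spatialQuantile {d : ℕ} (F : Measure (EuclideanSpace ℝ (Fin d)))
    (u : EuclideanSpace ℝ (Fin d)) : EuclideanSpace ℝ (Fin d) :=
  Classical.epsilon (IsSpatialQuantile F u)

/-- The empirical distribution of the data `x_1, …, x_n`. -/
def empiricalDistribution {d n : ℕ} (x : Fin n → EuclideanSpace ℝ (Fin d)) :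
    Measure (EuclideanSpace ℝ (Fin d)) :=
  (n : ENNReal)⁻¹ • ∑ i, Measure.dirac (x i)

/-- The empirical spatial quantile of the data `x_1, …, x_n`. -/
def empiricalSpatialQuantile {d n : ℕ} (x : Fin n → EuclideanSpace ℝ (Fin d))
    (u : EuclideanSpace ℝ (Fin d)) : EuclideanSpace ℝ (Fin d) :=
  spatialQuantile (empiricalDistribution x) u

open Classical in
/-- The spatial rank of `z` with respect to the data `x_1, …, x_n`. -/
def spatialRank {d n : ℕ} (x : Fin n → EuclideanSpace ℝ (Fin d))
    (z : EuclideanSpace ℝ (Fin d)) : EuclideanSpace ℝ (Fin d) :=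
  (n : ℝ)⁻¹ • ∑ i with x i ≠ z, ‖z - x i‖⁻¹ • (z - x i)

/-- The `n + m` spatial ranks of the observations, each within its own data set. -/
def pooledRank {d n m : ℕ} (x : Fin n → EuclideanSpace ℝ (Fin d))
    (y : Fin m → EuclideanSpace ℝ (Fin d)) : Fin n ⊕ Fin m → EuclideanSpace ℝ (Fin d) :=
  Sum.elim (fun k => spatialRank x (x k)) (fun k => spatialRank y (y k))

/-- The `i`-th two-sample Q-Q plot: the points `(Q_{X,i}(u_k), Q_{Y,i}(u_k))` in the plane for
those pooled ranks `u_k` that lie in the closed ball of radius `r` around the origin. -/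
def qqPlot {d n m : ℕ} (r : ℝ) (x : Fin n → EuclideanSpace ℝ (Fin d))
    (y : Fin m → EuclideanSpace ℝ (Fin d)) (i : Fin d) : Set (EuclideanSpace ℝ (Fin 2)) :=
  {p | ∃ k, pooledRank x y k ∈ Metric.closedBall 0 r ∧
    p = !₂[empiricalSpatialQuantile x (pooledRank x y k) i,
           empiricalSpatialQuantile y (pooledRank x y k) i]}

/-- The `ε`-neighborhood of the line with slope `1` and intercept `0` in the plane. -/
def lineNeighborhood (ε : ℝ) : Set (EuclideanSpace ℝ (Fin 2)) :=
  Metric.thickening ε {p | p 1 = p 0}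

/-- `F` has a positive Lebesgue density that is bounded on every bounded subset of `ℝ^d`. -/
def HasPositiveLocallyBoundedDensity {d : ℕ}
    (F : Measure (EuclideanSpace ℝ (Fin d))) : Prop :=
  ∃ f : EuclideanSpace ℝ (Fin d) → ℝ, Measurable f ∧ (∀ x, 0 < f x) ∧
    (∀ s, Bornology.IsBounded s → ∃ C, ∀ x ∈ s, f x ≤ C) ∧
    F = volume.withDensity fun x => ENNReal.ofReal (f x)

end

/-! The norm potential `Q ↦ E (‖x - Q‖ - ‖x‖)` of a distribution is convex. Its subgradients are
the spatial ranks, and a spatial quantile at level `u` is a point at which `u` is a subgradient,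
so that quantiles and ranks are inverse to each other. By the law of large numbers the empirical
potentials converge in probability, and convexity turns this into consistency of the empirical
quantiles and ranks, locally uniformly in the level and in the point.

If `F = G`, both empirical quantile maps converge to the same limit uniformly on the ball of
radius `r`, so the Q-Q plots approach the diagonal. If `F ≠ G`, then the norm potentials differ,
because up to a constant factor the second differences of the norm are the Fourier transform of
an almost everywhere positive kernel. Hence the rank maps differ at some point `p`, and the
sample points near `p` contribute points to the Q-Q plots that stay away from the diagonal. -/

theorem eventually_forall_mem_of_isCompact {ι Y : Type*} [TopologicalSpace Y] {K : Set Y}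
    (hK : IsCompact K) {l : Filter ι} {p : ι → Y → Prop}
    (h : ∀ y ∈ K, ∀ᶠ z in l ×ˢ 𝓝 y, p z.1 z.2) : ∀ᶠ i in l, ∀ y ∈ K, p i y := by
  have h' : ∀ᶠ z in l ×ˢ 𝓝ˢ K, p z.1 z.2 :=
    hK.mem_prod_nhdsSet_of_forall (s := {z | p z.1 z.2}) h
  exact h'.curry.mono fun i hi y hy => hi.self_of_nhdsSet y hy

section Subgradient

variable {E : Type*} [NormedAddCommGroup E] [InnerProductSpace ℝ E] {f : E → ℝ} {u p q : E}

/-- `u` is a subgradient of `f` at `q`. When `f` is the norm potential of a distribution, this is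
the duality between ranks and quantiles: `q` is a spatial quantile at level `u`, and `u` is a
spatial rank of `q`. -/
def HasSubgradientAt (f : E → ℝ) (u q : E) : Prop :=
  ∀ Q, f q + inner ℝ u (Q - q) ≤ f Q

theorem hasSubgradientAt_iff_forall_sub_inner_le :
    HasSubgradientAt f u q ↔ ∀ Q, f q - inner ℝ u q ≤ f Q - inner ℝ u Q := by
  refine forall_congr' fun Q => ?_
  rw [inner_sub_right]
  constructor <;> intro h <;> linarith

theorem hasSubgradientAt_norm (v : E) : HasSubgradientAt (‖·‖) (‖v‖⁻¹ • v) v := by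
  intro Q
  have hunit : ‖‖v‖⁻¹ • v‖ ≤ 1 := by
    rw [norm_smul, norm_inv, norm_norm]
    exact inv_mul_le_one
  have hself : inner ℝ (‖v‖⁻¹ • v) v = ‖v‖ := by
    rw [real_inner_smul_left, real_inner_self_eq_norm_mul_norm, ← mul_assoc]
    simp
  calc ‖v‖ + inner ℝ (‖v‖⁻¹ • v) (Q - v) = inner ℝ (‖v‖⁻¹ • v) Q := by
        rw [inner_sub_right, hself]; ring
    _ ≤ ‖‖v‖⁻¹ • v‖ * ‖Q‖ := real_inner_le_norm _ _
    _ ≤ ‖Q‖ := mul_le_of_le_one_left (norm_nonneg Q) hunit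

theorem HasSubgradientAt.hasGradientAt [CompleteSpace E] (h : HasSubgradientAt f u q)
    (hf : DifferentiableAt ℝ f q) : HasGradientAt f u q := by
  have hmin : IsLocalMin (fun Q => f Q - inner ℝ u Q) q :=
    Eventually.of_forall (hasSubgradientAt_iff_forall_sub_inner_le.1 h)
  have hderiv := hf.hasFDerivAt.sub (InnerProductSpace.toDual ℝ E u).hasFDerivAt
  rw [hasGradientAt_iff_hasFDerivAt, ← sub_eq_zero.1 (hmin.hasFDerivAt_eq_zero hderiv)]
  exact hf.hasFDerivAt

theorem HasSubgradientAt.lt_of_strictConvexOn (h : HasSubgradientAt f u q)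
    (hf : StrictConvexOn ℝ Set.univ f) (hpq : p ≠ q) : f q + inner ℝ u (p - q) < f p := by
  have hstrict := hf.2 (Set.mem_univ p) (Set.mem_univ q) hpq (by norm_num : (0 : ℝ) < 2⁻¹)
    (by norm_num : (0 : ℝ) < 2⁻¹) (by norm_num)
  have hmid := h ((2⁻¹ : ℝ) • p + (2⁻¹ : ℝ) • q)
  rw [show (2⁻¹ : ℝ) • p + (2⁻¹ : ℝ) • q - q = (2⁻¹ : ℝ) • (p - q) by module,
    inner_smul_right] at hmid
  simp only [smul_eq_mul] at hstrict
  linarith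

theorem HasSubgradientAt.norm_sub_lt_of_forall_sphere (h : HasSubgradientAt f u q) {v : E}
    {t η : ℝ} (ht : 0 < t) (hη : 0 < η)
    (hsphere : ∀ w ∈ Metric.sphere (0 : E) t, f (q + w) - f q < inner ℝ v w + t * η) :
    ‖u - v‖ < η := by
  rcases eq_or_ne u v with rfl | hne
  · simpa using hη
  -- The increment in the direction of `u - v` detects `‖u - v‖`.
  have hpos : 0 < ‖u - v‖ := norm_pos_iff.2 (sub_ne_zero.2 hne)
  set w : E := (t / ‖u - v‖) • (u - v)
  have hw : w ∈ Metric.sphere (0 : E) t := by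
    rw [mem_sphere_zero_iff_norm, norm_smul, Real.norm_of_nonneg (by positivity),
      div_mul_cancel₀ _ hpos.ne']
  have hinner : inner ℝ u w - inner ℝ v w = t * ‖u - v‖ := by
    rw [← inner_sub_left, inner_smul_right, real_inner_self_eq_norm_sq]
    field_simp
  have hsub := h (q + w)
  rw [add_sub_cancel_left] at hsub
  refine lt_of_mul_lt_mul_left ?_ ht.le
  linarith [hsphere w hw]

theorem add_inner_lt_of_forall_sphere_lt {g : E → ℝ} (hg : ConvexOn ℝ Set.univ g) {q₀ : E} {ε : ℝ}
    (hε : 0 < ε) (hsphere : ∀ p ∈ Metric.sphere q₀ ε, g q₀ + inner ℝ u (p - q₀) < g p)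
    (hp : ε ≤ ‖p - q₀‖) : g q₀ + inner ℝ u (p - q₀) < g p := by
  have hp0 : 0 < ‖p - q₀‖ := hε.trans_le hp
  set t := ε / ‖p - q₀‖
  have ht0 : 0 < t := div_pos hε hp0
  have ht1 : t ≤ 1 := (div_le_one hp0).2 hp
  have hsub : (1 - t) • q₀ + t • p - q₀ = t • (p - q₀) := by module
  have hmem : (1 - t) • q₀ + t • p ∈ Metric.sphere q₀ ε := by
    rw [mem_sphere_iff_norm, hsub, norm_smul, Real.norm_of_nonneg ht0.le,
      div_mul_cancel₀ _ hp0.ne']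
  have hlt := hsphere _ hmem
  have hconv := hg.2 (Set.mem_univ q₀) (Set.mem_univ p) (sub_nonneg.2 ht1) ht0.le (by ring)
  rw [hsub, inner_smul_right] at hlt
  simp only [smul_eq_mul] at hconv
  refine lt_of_mul_lt_mul_left ?_ ht0.le
  linarith

variable {ι : Type*} {l : Filter ι} {g : ι → E → ℝ} {u₀ q₀ : E}

section Stability

variable [FiniteDimensional ℝ E]

theorem exists_hasSubgradientAt_of_forall_lt (hf : Continuous f) {q₀ : E} {ε : ℝ}
    (hfar : ∀ p, ε ≤ ‖p - q₀‖ → f q₀ + inner ℝ u (p - q₀) < f p) :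
    ∃ q, HasSubgradientAt f u q := by
  have hfar' : ∀ᶠ p in cocompact E, f q₀ - inner ℝ u q₀ ≤ f p - inner ℝ u p := by
    filter_upwards [(isCompact_closedBall q₀ ε).compl_mem_cocompact] with p hp
    have hlt := hfar p (not_le.1 fun hle => hp (mem_closedBall_iff_norm.2 hle)).le
    rw [inner_sub_right] at hlt
    linarith
  obtain ⟨q, hq⟩ := Continuous.exists_forall_le' (f := fun Q => f Q - inner ℝ u Q)
    (by fun_prop) q₀ hfar'
  exact ⟨q, hasSubgradientAt_iff_forall_sub_inner_le.2 hq⟩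

theorem eventually_hasSubgradientAt_near (hg : ∀ i, ConvexOn ℝ Set.univ (g i))
    (hgf : ∀ p, Tendsto (fun z : ι × E => g z.1 z.2) (l ×ˢ 𝓝 p) (𝓝 (f p)))
    (hf : StrictConvexOn ℝ Set.univ f) (h₀ : HasSubgradientAt f u₀ q₀) {ε : ℝ} (hε : 0 < ε) :
    ∀ᶠ z in l ×ˢ 𝓝 u₀, (∃ q, HasSubgradientAt (g z.1) z.2 q) ∧
      ∀ q, HasSubgradientAt (g z.1) z.2 q → ‖q - q₀‖ < ε := by
  have hsphere : ∀ᶠ z in l ×ˢ 𝓝 u₀, ∀ p ∈ Metric.sphere q₀ ε,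
      g z.1 q₀ + inner ℝ z.2 (p - q₀) < g z.1 p := by
    refine eventually_forall_mem_of_isCompact (isCompact_sphere q₀ ε) fun p hp => ?_
    have hcenter : Tendsto (fun i => g i q₀) l (𝓝 (f q₀)) :=
      (hgf q₀).comp (tendsto_id.prodMk tendsto_const_nhds)
    have hleft : Tendsto (fun z : (ι × E) × E => g z.1.1 q₀ + inner ℝ z.1.2 (z.2 - q₀))
        ((l ×ˢ 𝓝 u₀) ×ˢ 𝓝 p) (𝓝 (f q₀ + inner ℝ u₀ (p - q₀))) :=
      (hcenter.comp (tendsto_fst.comp tendsto_fst)).add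
        ((tendsto_snd.comp tendsto_fst).inner (tendsto_snd.sub_const q₀))
    have hright : Tendsto (fun z : (ι × E) × E => g z.1.1 z.2) ((l ×ˢ 𝓝 u₀) ×ˢ 𝓝 p) (𝓝 (f p)) :=
      (hgf p).comp ((tendsto_fst.comp tendsto_fst).prodMk tendsto_snd)
    exact hleft.eventually_lt hright
      (h₀.lt_of_strictConvexOn hf (Metric.ne_of_mem_sphere hp hε.ne'))
  filter_upwards [hsphere] with z hz
  have hfar : ∀ p, ε ≤ ‖p - q₀‖ → g z.1 q₀ + inner ℝ z.2 (p - q₀) < g z.1 p :=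
    fun p => add_inner_lt_of_forall_sphere_lt (hg z.1) hε hz
  refine ⟨?_, fun q hq => ?_⟩
  · exact exists_hasSubgradientAt_of_forall_lt (hg z.1).locallyLipschitz.continuous hfar
  · by_contra! hle
    have hlt := hfar q hle
    have hle' := hq q₀
    rw [← neg_sub q q₀, inner_neg_right] at hle'
    linarith

theorem eventually_subgradient_near
    (hgf : ∀ p, Tendsto (fun z : ι × E => g z.1 z.2) (l ×ˢ 𝓝 p) (𝓝 (f p)))
    (h₀ : HasGradientAt f u₀ q₀) {η : ℝ} (hη : 0 < η) :
    ∀ᶠ z in l ×ˢ 𝓝 q₀, ∀ u, HasSubgradientAt (g z.1) u z.2 → ‖u - u₀‖ < η := by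
  obtain ⟨t, ht, hdiff⟩ : ∃ t > 0, ∀ w ∈ Metric.sphere (0 : E) t,
      f (q₀ + w) - f q₀ < inner ℝ u₀ w + t * η := by
    obtain ⟨s, hs, hball⟩ := Metric.eventually_nhds_iff.1
      (h₀.hasFDerivAt.isLittleO.def (half_pos hη))
    refine ⟨s / 2, half_pos hs, fun w hw => ?_⟩
    have hwn : ‖w‖ = s / 2 := by simpa using hw
    have hle := hball (y := q₀ + w) (by simp [hwn, hs])
    simp only [add_sub_cancel_left, InnerProductSpace.toDual_apply_apply, Real.norm_eq_abs,
      hwn] at hle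
    linarith [(abs_le.1 hle).2, mul_pos hs hη]
  have hsphere : ∀ᶠ z in l ×ˢ 𝓝 q₀, ∀ w ∈ Metric.sphere (0 : E) t,
      g z.1 (z.2 + w) - g z.1 z.2 < inner ℝ u₀ w + t * η := by
    refine eventually_forall_mem_of_isCompact (isCompact_sphere 0 t) fun w hw => ?_
    have hshift : Tendsto (fun z : (ι × E) × E => g z.1.1 (z.1.2 + z.2))
        ((l ×ˢ 𝓝 q₀) ×ˢ 𝓝 w) (𝓝 (f (q₀ + w))) :=
      (hgf (q₀ + w)).comp ((tendsto_fst.comp tendsto_fst).prodMk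
        ((tendsto_snd.comp tendsto_fst).add tendsto_snd))
    have hbound : Tendsto (fun z : (ι × E) × E => inner ℝ u₀ z.2 + t * η)
        ((l ×ˢ 𝓝 q₀) ×ˢ 𝓝 w) (𝓝 (inner ℝ u₀ w + t * η)) :=
      (tendsto_const_nhds.inner tendsto_snd).add_const _
    exact (hshift.sub ((hgf q₀).comp tendsto_fst)).eventually_lt hbound (hdiff w hw)
  filter_upwards [hsphere] with z hz u hu
  exact hu.norm_sub_lt_of_forall_sphere ht hη hz

end Stability

end Subgradient

section NormPotential

/-- The norm potential of `μ`: up to the linear term `⟪u, Q⟫` it is the objective function of the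
spatial quantiles of `μ`, and its gradient is the spatial rank. Subtracting `‖x‖` keeps the
integrand bounded, so that no moments are needed. -/
noncomputable def normPotential {E : Type*} [NormedAddCommGroup E] [MeasurableSpace E]
    (μ : Measure E) (Q : E) : ℝ :=
  ∫ x, (‖x - Q‖ - ‖x‖) ∂μ

/-- The spatial rank of `z` with respect to `μ`, that is, the mean direction from `x` to `z`. The
convention `0⁻¹ = 0` makes an atom at `z` contribute nothing. -/
noncomputable def populationRank {E : Type*} [NormedAddCommGroup E] [NormedSpace ℝ E]
    [MeasurableSpace E] (μ : Measure E) (z : E) : E :=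
  ∫ x, ‖z - x‖⁻¹ • (z - x) ∂μ

section NormedGroup

variable {E : Type*} [NormedAddCommGroup E]

theorem abs_norm_sub_sub_norm_sub_le (x p q : E) : |‖x - p‖ - ‖x - q‖| ≤ ‖p - q‖ := by
  simpa [norm_sub_rev] using abs_norm_sub_norm_le (x - p) (x - q)

theorem abs_norm_sub_sub_norm_le (x Q : E) : |‖x - Q‖ - ‖x‖| ≤ ‖Q‖ := by
  simpa using abs_norm_sub_sub_norm_sub_le x Q 0

theorem jensenGap_norm_nonneg [NormedSpace ℝ E] (x p q : E) {a b : ℝ} (ha : 0 ≤ a)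
    (hb : 0 ≤ b) (hab : a + b = 1) :
    0 ≤ a * (‖x - p‖ - ‖x - (a • p + b • q)‖) + b * (‖x - q‖ - ‖x - (a • p + b • q)‖) := by
  have hx : x - (a • p + b • q) = a • (x - p) + b • (x - q) := by
    rw [smul_sub, smul_sub, sub_add_sub_comm, ← add_smul, hab, one_smul]
  have hconv := convexOn_univ_norm.2 (Set.mem_univ (x - p)) (Set.mem_univ (x - q)) ha hb hab
  rw [← hx, smul_eq_mul, smul_eq_mul] at hconv
  linear_combination hconv + ‖x - (a • p + b • q)‖ * hab

variable [MeasurableSpace E]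

@[simp] theorem normPotential_zero (μ : Measure E) : normPotential μ 0 = 0 := by
  simp [normPotential]

variable [OpensMeasurableSpace E] (μ : Measure E)

theorem integrable_norm_sub_sub_norm_sub [IsFiniteMeasure μ] (p q : E) :
    Integrable (fun x => ‖x - p‖ - ‖x - q‖) μ :=
  Integrable.of_bound (C := ‖p - q‖) (Continuous.aestronglyMeasurable (by fun_prop))
    (Eventually.of_forall fun x => abs_norm_sub_sub_norm_sub_le x p q)

theorem integrable_norm_sub_sub_norm [IsFiniteMeasure μ] (Q : E) :
    Integrable (fun x => ‖x - Q‖ - ‖x‖) μ := by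
  simpa using integrable_norm_sub_sub_norm_sub μ Q 0

theorem normPotential_sub [IsFiniteMeasure μ] (p q : E) :
    normPotential μ p - normPotential μ q = ∫ x, (‖x - p‖ - ‖x - q‖) ∂μ := by
  simp only [normPotential, ← integral_sub (integrable_norm_sub_sub_norm μ p)
    (integrable_norm_sub_sub_norm μ q), sub_sub_sub_cancel_right]

theorem abs_normPotential_sub_le [IsZeroOrProbabilityMeasure μ] (p q : E) :
    |normPotential μ p - normPotential μ q| ≤ ‖p - q‖ := by
  rw [normPotential_sub, ← Real.norm_eq_abs]
  calc ‖∫ x, (‖x - p‖ - ‖x - q‖) ∂μ‖ ≤ ‖p - q‖ * μ.real Set.univ :=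
        norm_integral_le_of_norm_le_const
          (Eventually.of_forall fun x => abs_norm_sub_sub_norm_sub_le x p q)
    _ ≤ ‖p - q‖ := mul_le_of_le_one_right (norm_nonneg _) measureReal_le_one

theorem lipschitzWith_normPotential [IsZeroOrProbabilityMeasure μ] :
    LipschitzWith 1 (normPotential μ) :=
  LipschitzWith.of_dist_le_mul fun p q => by
    simpa [dist_eq_norm] using abs_normPotential_sub_le μ p q

theorem normPotential_sub_lt [IsProbabilityMeasure μ] [μ.IsOpenPosMeasure] {p q : E}
    (hpq : p ≠ q) : normPotential μ p - normPotential μ q < ‖p - q‖ := by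
  have hint := integrable_norm_sub_sub_norm_sub μ p q
  have hpos : 0 < ∫ x, (‖p - q‖ - (‖x - p‖ - ‖x - q‖)) ∂μ := by
    refine integral_pos_of_integrable_nonneg_nonzero (x := p) (by fun_prop)
      ((integrable_const _).sub hint)
      (fun x => sub_nonneg.2 (abs_le.1 (abs_norm_sub_sub_norm_sub_le x p q)).2) ?_
    simpa [← two_mul, sub_eq_zero] using hpq
  rw [integral_sub (integrable_const _) hint, ← normPotential_sub] at hpos
  simpa using hpos

theorem integral_jensenGap_norm [IsFiniteMeasure μ] (p q c : E) (a b : ℝ) :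
    ∫ x, (a * (‖x - p‖ - ‖x - c‖) + b * (‖x - q‖ - ‖x - c‖)) ∂μ =
      a * (normPotential μ p - normPotential μ c) +
        b * (normPotential μ q - normPotential μ c) := by
  rw [integral_add ((integrable_norm_sub_sub_norm_sub μ p c).const_mul a)
    ((integrable_norm_sub_sub_norm_sub μ q c).const_mul b), integral_const_mul,
    integral_const_mul, normPotential_sub, normPotential_sub]

theorem tendsto_normPotential_div_norm [IsProbabilityMeasure μ] :
    Tendsto (fun Q => normPotential μ Q / ‖Q‖) (Bornology.cobounded E) (𝓝 1) := by
  have hpointwise : ∀ x : E,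
      Tendsto (fun Q => (‖x - Q‖ - ‖x‖) / ‖Q‖) (Bornology.cobounded E) (𝓝 1) := by
    intro x
    have hlower : Tendsto (fun Q : E => 1 - 2 * ‖x‖ / ‖Q‖) (Bornology.cobounded E) (𝓝 1) := by
      simpa using tendsto_const_nhds.sub (tendsto_norm_cobounded_atTop.const_div_atTop (2 * ‖x‖))
    refine tendsto_of_tendsto_of_tendsto_of_le_of_le' hlower tendsto_const_nhds ?_ ?_
    · filter_upwards [tendsto_norm_cobounded_atTop.eventually_gt_atTop 0] with Q hQ
      rw [le_div_iff₀ hQ, sub_mul, div_mul_cancel₀ _ hQ.ne', one_mul]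
      linarith [norm_sub_norm_le Q x, norm_sub_rev Q x]
    · exact Eventually.of_forall fun Q =>
        div_le_one_of_le₀ (abs_le.1 (abs_norm_sub_sub_norm_le x Q)).2 (norm_nonneg Q)
  have hcount : (Bornology.cobounded E).IsCountablyGenerated := by
    rw [← comap_norm_atTop]; infer_instance
  simp only [normPotential, ← integral_div]
  simpa using tendsto_integral_filter_of_dominated_convergence (μ := μ) (f := fun _ => 1) 1
    (Eventually.of_forall fun Q => Continuous.aestronglyMeasurable (by fun_prop))
    (Eventually.of_forall fun Q => Eventually.of_forall fun x => by
      rw [norm_div, norm_norm]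
      exact div_le_one_of_le₀ (abs_norm_sub_sub_norm_le x Q) (norm_nonneg Q))
    (integrable_const _) (Eventually.of_forall hpointwise)

end NormedGroup

section NormedSpace

variable {E : Type*} [NormedAddCommGroup E] [NormedSpace ℝ E] [MeasurableSpace E]
  [OpensMeasurableSpace E] (μ : Measure E)

theorem convexOn_normPotential [IsFiniteMeasure μ] : ConvexOn ℝ Set.univ (normPotential μ) := by
  refine ⟨convex_univ, fun p _ q _ a b ha hb hab => ?_⟩
  have hnonneg : 0 ≤ ∫ x, (a * (‖x - p‖ - ‖x - (a • p + b • q)‖) +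
      b * (‖x - q‖ - ‖x - (a • p + b • q)‖)) ∂μ :=
    integral_nonneg fun x => jensenGap_norm_nonneg x p q ha hb hab
  rw [integral_jensenGap_norm] at hnonneg
  simp only [smul_eq_mul]
  linear_combination hnonneg - normPotential μ (a • p + b • q) * hab

theorem strictConvexOn_normPotential [IsFiniteMeasure μ] [μ.IsOpenPosMeasure] :
    StrictConvexOn ℝ Set.univ (normPotential μ) := by
  refine ⟨convex_univ, fun p _ q _ hpq a b ha hb hab => ?_⟩
  -- Convexity of the norm is strict for the displacements from the intermediate point itself.
  have hgap : 0 < a * ‖a • p + b • q - p‖ + b * ‖a • p + b • q - q‖ := by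
    have hne : a • p + b • q ≠ p := by
      rw [← sub_ne_zero, show a • p + b • q - p = b • (q - p) by
        rw [show a = 1 - b by linarith]; module]
      exact smul_ne_zero hb.ne' (sub_ne_zero.2 hpq.symm)
    have := norm_pos_iff.2 (sub_ne_zero.2 hne)
    positivity
  have hpos : 0 < ∫ x, (a * (‖x - p‖ - ‖x - (a • p + b • q)‖) +
      b * (‖x - q‖ - ‖x - (a • p + b • q)‖)) ∂μ := by
    refine integral_pos_of_integrable_nonneg_nonzero (x := a • p + b • q) (by fun_prop)
      (((integrable_norm_sub_sub_norm_sub μ _ _).const_mul a).fun_add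
        ((integrable_norm_sub_sub_norm_sub μ _ _).const_mul b))
      (fun x => jensenGap_norm_nonneg x p q ha.le hb.le hab) ?_
    simpa only [sub_self, norm_zero, sub_zero] using hgap.ne'
  rw [integral_jensenGap_norm] at hpos
  simp only [smul_eq_mul]
  linear_combination hpos - normPotential μ (a • p + b • q) * hab

end NormedSpace

section InnerProductSpace

variable {E : Type*} [NormedAddCommGroup E] [InnerProductSpace ℝ E] [MeasurableSpace E]

theorem HasSubgradientAt.norm_lt_one [OpensMeasurableSpace E] {μ : Measure E}
    [IsProbabilityMeasure μ] [μ.IsOpenPosMeasure] {u q : E}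
    (h : HasSubgradientAt (normPotential μ) u q) : ‖u‖ < 1 := by
  rcases eq_or_ne u 0 with rfl | hu
  · simp
  have hlt := normPotential_sub_lt μ (p := q + u) (q := q) (by simpa using hu)
  have hle := h (q + u)
  rw [add_sub_cancel_left] at hlt hle
  rw [real_inner_self_eq_norm_mul_norm] at hle
  nlinarith [norm_pos_iff.2 hu]

variable [BorelSpace E] [FiniteDimensional ℝ E] (μ : Measure E)

theorem exists_hasSubgradientAt_normPotential [IsProbabilityMeasure μ] {u : E} (hu : ‖u‖ < 1) :
    ∃ q, HasSubgradientAt (normPotential μ) u q := by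
  have hgrowth : ∀ᶠ Q in cocompact E,
      (1 - ‖u‖) / 2 * ‖Q‖ ≤ normPotential μ Q - inner ℝ u Q := by
    rw [← Metric.cobounded_eq_cocompact]
    filter_upwards [(tendsto_normPotential_div_norm μ).eventually
        (lt_mem_nhds (show (1 + ‖u‖) / 2 < 1 by linarith)),
      tendsto_norm_cobounded_atTop.eventually_gt_atTop 0] with Q hQ hpos
    rw [lt_div_iff₀ hpos] at hQ
    linarith [real_inner_le_norm u Q]
  have hcoercive : Tendsto (fun Q => normPotential μ Q - inner ℝ u Q) (cocompact E) atTop :=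
    tendsto_atTop_mono' _ hgrowth (tendsto_norm_cocompact_atTop.const_mul_atTop (by linarith))
  have hcont := (lipschitzWith_normPotential μ).continuous
  obtain ⟨q, hq⟩ := Continuous.exists_forall_le
    (f := fun Q => normPotential μ Q - inner ℝ u Q) (by fun_prop) hcoercive
  exact ⟨q, hasSubgradientAt_iff_forall_sub_inner_le.2 hq⟩

theorem hasSubgradientAt_populationRank [IsFiniteMeasure μ] (z : E) :
    HasSubgradientAt (normPotential μ) (populationRank μ z) z := by
  have hint : Integrable (fun x => ‖z - x‖⁻¹ • (z - x)) μ := by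
    refine Integrable.of_bound (C := 1) (Measurable.aestronglyMeasurable (by fun_prop))
      (Eventually.of_forall fun x => ?_)
    rw [norm_smul, norm_inv, norm_norm]
    exact inv_mul_le_one
  intro Q
  rw [← le_sub_iff_add_le', normPotential_sub, real_inner_comm, populationRank,
    ← integral_inner hint]
  refine integral_mono (hint.const_inner _) (integrable_norm_sub_sub_norm_sub μ Q z) fun x => ?_
  have h := hasSubgradientAt_norm (z - x) (Q - x)
  simp only [sub_sub_sub_cancel_right] at h
  simp only
  rw [real_inner_comm, norm_sub_rev x Q, norm_sub_rev x z]
  linarith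

theorem differentiableAt_normPotential [IsFiniteMeasure μ] {q : E} (hq : μ {q} = 0) :
    DifferentiableAt ℝ (normPotential μ) q := by
  refine (hasFDerivAt_integral_of_dominated_loc_of_lip (𝕜 := ℝ) (s := Set.univ)
    (F := fun Q x => ‖x - Q‖ - ‖x‖) (bound := fun _ => (1 : ℝ))
    (F' := fun x => fderiv ℝ (fun Q => ‖x - Q‖ - ‖x‖) q) univ_mem
    (Eventually.of_forall fun Q => (integrable_norm_sub_sub_norm μ Q).aestronglyMeasurable)
    (integrable_norm_sub_sub_norm μ q) ?_ ?_ (integrable_const _) ?_).2.differentiableAt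
  · exact ((measurable_fderiv_with_param ℝ (f := fun x Q : E => ‖x - Q‖ - ‖x‖)
      (by fun_prop)).comp measurable_prodMk_right).aestronglyMeasurable
  · refine Eventually.of_forall fun x =>
      (LipschitzWith.of_dist_le_mul fun a b => ?_).lipschitzOnWith
    simpa [Real.dist_eq, dist_eq_norm] using abs_norm_sub_sub_norm_sub_le x a b
  · filter_upwards [measure_eq_zero_iff_ae_notMem.1 hq] with x hx
    have hne : x - q ≠ 0 := sub_ne_zero.2 hx
    exact ((((differentiableAt_const x).sub differentiableAt_id).norm ℝ hne).sub_const
      _).hasFDerivAt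

theorem hasGradientAt_normPotential [IsFiniteMeasure μ] {q : E} (hq : μ {q} = 0) :
    HasGradientAt (normPotential μ) (populationRank μ q) q :=
  (hasSubgradientAt_populationRank μ q).hasGradientAt (differentiableAt_normPotential μ hq)

end InnerProductSpace

end NormPotential

section Injectivity

open Module

variable {E : Type*} [NormedAddCommGroup E] [InnerProductSpace ℝ E]

/-- The kernel of the Fourier representation of the norm: its integral over `ξ` is a multiple of
`‖y‖`, as rotation invariance and scaling show. -/
noncomputable def cosKernel (y ξ : E) : ℝ :=
  (1 - Real.cos (inner ℝ y ξ)) / ‖ξ‖ ^ (finrank ℝ E + 1)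

theorem exists_cosKernel_ne_zero {ξ : E} (hξ : ξ ≠ 0) : ∃ Q, cosKernel Q ξ ≠ 0 := by
  have hξ' : ‖ξ‖ ≠ 0 := norm_ne_zero_iff.2 hξ
  have hinner : inner ℝ ((Real.pi / ‖ξ‖ ^ 2) • ξ) ξ = Real.pi := by
    rw [real_inner_smul_left, real_inner_self_eq_norm_sq, div_mul_cancel₀ _ (pow_ne_zero 2 hξ')]
  refine ⟨(Real.pi / ‖ξ‖ ^ 2) • ξ, ?_⟩
  rw [cosKernel, hinner, Real.cos_pi]
  positivity

variable [MeasurableSpace E] [BorelSpace E]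

theorem measurable_cosKernel (y : E) : Measurable (cosKernel y) := by
  unfold cosKernel
  exact (measurable_const.sub (Real.measurable_cos.comp
    (continuous_const.inner continuous_id).measurable)).div (measurable_norm.pow_const _)

variable [FiniteDimensional ℝ E]

theorem integrable_min_sq_div_norm_pow [Nontrivial E] :
    Integrable (fun ξ : E => min 1 (‖ξ‖ ^ 2) / ‖ξ‖ ^ (finrank ℝ E + 1)) := by
  rw [integrable_fun_norm_addHaar volume (f := fun r => min 1 (r ^ 2) / r ^ (finrank ℝ E + 1))]
  have hD : finrank ℝ E + 1 = (finrank ℝ E - 1) + 2 := by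
    have := finrank_pos (R := ℝ) (M := E)
    omega
  have heq : ∀ r ∈ Set.Ioi (0 : ℝ),
      min 1 (r ^ 2) / r ^ 2 = r ^ (finrank ℝ E - 1) • (min 1 (r ^ 2) / r ^ (finrank ℝ E + 1)) := by
    intro r hr
    have hr0 : r ≠ 0 := ne_of_gt hr
    rw [hD, smul_eq_mul, pow_add]
    field_simp
  refine IntegrableOn.congr_fun ?_ heq measurableSet_Ioi
  rw [← Set.Ioc_union_Ioi_eq_Ioi (zero_le_one (α := ℝ))]
  refine IntegrableOn.union ?_ ?_
  · refine Measure.integrableOn_of_bounded (M := 1) (by simp)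
      (Measurable.aestronglyMeasurable (by fun_prop)) ?_
    filter_upwards with r
    rw [Real.norm_of_nonneg (by positivity)]
    exact div_le_one_of_le₀ (min_le_right _ _) (by positivity)
  · refine Integrable.mono' (integrableOn_Ioi_rpow_of_lt (a := -2) (by norm_num) one_pos)
      (Measurable.aestronglyMeasurable (by fun_prop)) ?_
    filter_upwards [ae_restrict_mem measurableSet_Ioi] with r hr
    have hr0 : (0 : ℝ) < r := lt_trans one_pos hr
    rw [Real.norm_of_nonneg (by positivity), Real.rpow_neg hr0.le, Real.rpow_two, ← one_div]
    gcongr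
    exact min_le_left _ _

theorem integrable_cosKernel [Nontrivial E] (y : E) : Integrable (cosKernel y) := by
  refine Integrable.mono' (integrable_min_sq_div_norm_pow.const_mul (2 + ‖y‖ ^ 2))
    (measurable_cosKernel y).aestronglyMeasurable (Eventually.of_forall fun ξ => ?_)
  have h0 : 0 ≤ 1 - Real.cos (inner ℝ y ξ) := by linarith [Real.cos_le_one (inner ℝ y ξ)]
  have h2 : 1 - Real.cos (inner ℝ y ξ) ≤ 2 := by linarith [Real.neg_one_le_cos (inner ℝ y ξ)]
  have hsq : 1 - Real.cos (inner ℝ y ξ) ≤ ‖y‖ ^ 2 * ‖ξ‖ ^ 2 := by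
    have h := Real.one_sub_sq_div_two_le_cos (x := inner ℝ y ξ)
    have hc : (inner ℝ y ξ) ^ 2 ≤ (‖y‖ * ‖ξ‖) ^ 2 := sq_le_sq.2 <| by
      simpa [abs_mul] using abs_real_inner_le_norm y ξ
    rw [mul_pow] at hc
    nlinarith [sq_nonneg (inner ℝ y ξ)]
  unfold cosKernel
  rw [Real.norm_of_nonneg (by positivity), ← mul_div_assoc]
  gcongr
  rcases min_cases (1 : ℝ) (‖ξ‖ ^ 2) with ⟨h, _⟩ | ⟨h, _⟩ <;> rw [h]
  · nlinarith [sq_nonneg ‖y‖]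
  · nlinarith [sq_nonneg ‖ξ‖]

theorem integral_cosKernel_eq_of_norm_eq {y z : E} (h : ‖y‖ = ‖z‖) :
    ∫ ξ, cosKernel y ξ = ∫ ξ, cosKernel z ξ := by
  set T := (ℝ ∙ (y - z))ᗮ.reflection
  have hyz : T y = z := Submodule.reflection_sub h
  have hmp : MeasurePreserving T.toHomeomorph.toMeasurableEquiv volume volume :=
    T.measurePreserving
  rw [← hmp.integral_comp' (cosKernel z)]
  congr 1 with ξ
  rw [show T.toHomeomorph.toMeasurableEquiv ξ = T ξ from rfl, ← hyz]
  simp [cosKernel]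

theorem integral_cosKernel_smul (y : E) {t : ℝ} (ht : 0 < t) :
    ∫ ξ, cosKernel (t • y) ξ = t * ∫ ξ, cosKernel y ξ := by
  have h := Measure.integral_comp_smul volume (cosKernel y) t
  have hscale : ∀ ξ, cosKernel (t • y) ξ = t ^ (finrank ℝ E + 1) * cosKernel y (t • ξ) := by
    intro ξ
    unfold cosKernel
    rw [norm_smul, mul_pow, Real.norm_of_nonneg ht.le, inner_smul_left, inner_smul_right]
    simp only [conj_trivial]
    rw [mul_div_assoc', mul_div_mul_left _ _ (by positivity)]
  simp_rw [hscale]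
  rw [integral_const_mul, h, abs_of_pos (by positivity), smul_eq_mul, ← mul_assoc, pow_succ]
  field_simp

theorem exists_integral_cosKernel_eq [Nontrivial E] :
    ∃ κ : ℝ, ∀ y : E, ∫ ξ, cosKernel y ξ = κ * ‖y‖ := by
  obtain ⟨e, he⟩ := exists_norm_eq E (zero_le_one (α := ℝ))
  refine ⟨∫ ξ, cosKernel e ξ, fun y => ?_⟩
  rcases eq_or_ne y 0 with rfl | hy
  · simp [cosKernel]
  · have hy' : 0 < ‖y‖ := norm_pos_iff.2 hy
    rw [mul_comm, ← integral_cosKernel_smul e hy']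
    exact integral_cosKernel_eq_of_norm_eq (by simp [norm_smul, he])

theorem integral_cos_mul_cosKernel [Nontrivial E] {κ : ℝ}
    (hκ : ∀ y : E, ∫ ξ, cosKernel y ξ = κ * ‖y‖) (y Q : E) :
    ∫ ξ, Real.cos (inner ℝ y ξ) * cosKernel Q ξ =
      κ / 2 * (‖y + Q‖ + ‖y - Q‖ - 2 * ‖y‖) := by
  have hsecond : ∀ ξ, Real.cos (inner ℝ y ξ) * cosKernel Q ξ =
      2⁻¹ * ((cosKernel (y + Q) ξ + cosKernel (y - Q) ξ) - 2 * cosKernel y ξ) := by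
    intro ξ
    unfold cosKernel
    rw [inner_add_left, inner_sub_left, Real.cos_add, Real.cos_sub]
    ring
  simp_rw [hsecond]
  rw [integral_const_mul, integral_sub ((integrable_cosKernel _).fun_add (integrable_cosKernel _))
    ((integrable_cosKernel _).const_mul _), integral_add (integrable_cosKernel _)
    (integrable_cosKernel _), integral_const_mul, hκ, hκ, hκ]
  ring

theorem integrable_exp_inner_mul {k : E → ℂ} (hk : Integrable k) (y : E) :
    Integrable fun ξ => Complex.exp ((inner ℝ y ξ : ℝ) * Complex.I) * k ξ :=
  hk.bdd_mul (c := 1) (Continuous.aestronglyMeasurable (by fun_prop))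
    (Eventually.of_forall fun ξ => (Complex.norm_exp_ofReal_mul_I _).le)

theorem integral_exp_inner_mul_of_even {k : E → ℝ} (hk : Integrable k)
    (heven : ∀ ξ, k (-ξ) = k ξ) (y : E) :
    ∫ ξ, Complex.exp ((inner ℝ y ξ : ℝ) * Complex.I) * (k ξ : ℂ) =
      ((∫ ξ, Real.cos (inner ℝ y ξ) * k ξ : ℝ) : ℂ) := by
  have hneg : ∫ ξ, Complex.exp ((inner ℝ (-y) ξ : ℝ) * Complex.I) * (k ξ : ℂ) =
      ∫ ξ, Complex.exp ((inner ℝ y ξ : ℝ) * Complex.I) * (k ξ : ℂ) := by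
    rw [← integral_neg_eq_self]
    simp only [inner_neg_neg, heven]
  have hcos : ∀ ξ, ((Real.cos (inner ℝ y ξ) * k ξ : ℝ) : ℂ) =
      (Complex.exp ((inner ℝ y ξ : ℝ) * Complex.I) * (k ξ : ℂ) +
        Complex.exp ((inner ℝ (-y) ξ : ℝ) * Complex.I) * (k ξ : ℂ)) / 2 := by
    intro ξ
    push_cast [Complex.cos, inner_neg_left]
    ring
  have hk' : Integrable fun ξ => (k ξ : ℂ) := hk.ofReal
  simp_rw [← integral_complex_ofReal, hcos]
  rw [integral_div, integral_add (integrable_exp_inner_mul hk' y)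
    (integrable_exp_inner_mul hk' (-y)), hneg]
  ring

theorem integral_exp_mul_charFun_mul {k : E → ℂ} (hk : Integrable k) (μ : Measure E)
    [IsFiniteMeasure μ] (a : E) :
    ∫ ξ, Complex.exp ((inner ℝ (-a) ξ : ℝ) * Complex.I) * (charFun μ ξ * k ξ) =
      ∫ x, (∫ ξ, Complex.exp ((inner ℝ (x - a) ξ : ℝ) * Complex.I) * k ξ) ∂μ := by
  have hint : Integrable (Function.uncurry fun ξ x : E =>
      Complex.exp ((inner ℝ (x - a) ξ : ℝ) * Complex.I) * k ξ) (volume.prod μ) :=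
    (hk.comp_fst μ).bdd_mul (c := 1) (Continuous.aestronglyMeasurable (by fun_prop))
      (Eventually.of_forall fun z => (Complex.norm_exp_ofReal_mul_I _).le)
  refine (integral_congr_ae (Eventually.of_forall fun ξ => ?_)).trans (integral_integral_swap hint)
  rw [integral_mul_const, charFun_apply, ← mul_assoc, ← integral_const_mul]
  congr 2 with x
  rw [← Complex.exp_add, sub_eq_neg_add, inner_add_left, Complex.ofReal_add, add_mul]

theorem integral_exp_mul_charFun_mul_cosKernel [Nontrivial E] {κ : ℝ}
    (hκ : ∀ y : E, ∫ ξ, cosKernel y ξ = κ * ‖y‖) (μ : Measure E) [IsFiniteMeasure μ]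
    (Q a : E) :
    ∫ ξ, Complex.exp ((inner ℝ (-a) ξ : ℝ) * Complex.I) * (charFun μ ξ * (cosKernel Q ξ : ℂ)) =
      ((κ / 2 * (normPotential μ (a - Q) + normPotential μ (a + Q) -
        2 * normPotential μ a) : ℝ) : ℂ) := by
  have heven : ∀ ξ, cosKernel Q (-ξ) = cosKernel Q ξ := fun ξ => by simp [cosKernel]
  have hsecond : ∀ x, ‖x - a + Q‖ + ‖x - a - Q‖ - 2 * ‖x - a‖ =
      (‖x - (a - Q)‖ - ‖x - a‖) + (‖x - (a + Q)‖ - ‖x - a‖) := by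
    intro x
    rw [← sub_add, ← sub_sub]
    ring
  have hint := integrable_norm_sub_sub_norm_sub μ
  have hkernel : Integrable fun ξ => (cosKernel Q ξ : ℂ) := (integrable_cosKernel Q).ofReal
  rw [integral_exp_mul_charFun_mul hkernel]
  simp_rw [integral_exp_inner_mul_of_even (integrable_cosKernel Q) heven,
    integral_cos_mul_cosKernel hκ, hsecond]
  rw [integral_complex_ofReal, integral_const_mul, integral_add (hint _ _) (hint _ _),
    ← normPotential_sub, ← normPotential_sub]
  congr 2
  ring

theorem eq_of_integral_exp_mul_eq {f g : E → ℂ} (hf : Integrable f) (hg : Integrable g)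
    (h : ∀ a, ∫ ξ, Complex.exp ((inner ℝ (-a) ξ : ℝ) * Complex.I) * f ξ =
      ∫ ξ, Complex.exp ((inner ℝ (-a) ξ : ℝ) * Complex.I) * g ξ)
    {ξ : E} (hfξ : ContinuousAt f ξ) (hgξ : ContinuousAt g ξ) : f ξ = g ξ := by
  have hfourier : FourierTransform.fourier (f - g) = 0 := by
    funext w
    have hphase : ∀ v, ((-2 * Real.pi * inner ℝ v w : ℝ) : ℂ) =
        (inner ℝ (-((2 * Real.pi) • w)) v : ℝ) := by
      intro v
      rw [inner_neg_left, inner_smul_left, real_inner_comm]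
      simp
    simp only [Real.fourier_eq', Pi.zero_apply, Pi.sub_apply, smul_eq_mul, mul_sub, hphase]
    rw [integral_sub (integrable_exp_inner_mul hf _) (integrable_exp_inner_mul hg _), h, sub_self]
  have hinv := (hf.sub hg).fourierInv_fourier_eq
    (by rw [hfourier]; exact integrable_zero _ _ _) (hfξ.sub hgξ)
  rw [hfourier, Real.fourierInv_eq'] at hinv
  simpa [sub_eq_zero, eq_comm] using hinv

theorem eq_of_normPotential_eq {μ ν : Measure E} [IsProbabilityMeasure μ]
    [IsProbabilityMeasure ν] (h : normPotential μ = normPotential ν) : μ = ν := by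
  refine Measure.ext_of_charFun (funext fun ξ => ?_)
  rcases eq_or_ne ξ 0 with rfl | hξ
  · simp
  have : Nontrivial E := ⟨ξ, 0, hξ⟩
  obtain ⟨κ, hκ⟩ := exists_integral_cosKernel_eq (E := E)
  obtain ⟨Q, hQ⟩ := exists_cosKernel_ne_zero hξ
  have hint : ∀ (ρ : Measure E) [IsProbabilityMeasure ρ],
      Integrable fun ξ => charFun ρ ξ * (cosKernel Q ξ : ℂ) := fun ρ _ =>
    (integrable_cosKernel Q).ofReal.bdd_mul (c := 1)
      continuous_charFun.aestronglyMeasurable (Eventually.of_forall norm_charFun_le_one)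
  have hkernel : ContinuousAt (fun ξ => (cosKernel Q ξ : ℂ)) ξ := by
    unfold cosKernel
    exact Complex.continuous_ofReal.continuousAt.comp
      (ContinuousAt.div (by fun_prop) (by fun_prop) (pow_ne_zero _ (norm_ne_zero_iff.2 hξ)))
  refine mul_right_cancel₀ (Complex.ofReal_ne_zero.2 hQ)
    (eq_of_integral_exp_mul_eq (hint μ) (hint ν) (fun a => ?_)
      (continuous_charFun.continuousAt.mul hkernel) (continuous_charFun.continuousAt.mul hkernel))
  simp only [integral_exp_mul_charFun_mul_cosKernel hκ, h]

end Injectivity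

theorem eq_of_hasFDerivAt_zero_off_countable {E F : Type*} [NormedAddCommGroup E]
    [NormedSpace ℝ E] [NormedAddCommGroup F] [NormedSpace ℝ F] [CompleteSpace F] {f : E → F}
    {s : Set E} (hs : s.Countable) (hf : Continuous f)
    (hderiv : ∀ p ∉ s, HasFDerivAt f (0 : E →L[ℝ] F) p) (p q : E) : f p = f q := by
  rcases eq_or_ne p q with rfl | hpq
  · rfl
  have hline : ∀ t ∈ Set.Ioo (min (0 : ℝ) 1) (max 0 1) \ AffineMap.lineMap p q ⁻¹' s,
      HasDerivAt (f ∘ AffineMap.lineMap p q) 0 t := fun t ht => by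
    simpa using (hderiv _ ht.2).comp_hasDerivAt t AffineMap.hasDerivAt_lineMap
  have hint := integral_eq_of_hasDerivAt_off_countable (f ∘ AffineMap.lineMap p q) (fun _ => 0)
    (hs.preimage (AffineMap.lineMap_injective ℝ hpq))
    (by fun_prop) hline intervalIntegrable_const
  simpa [sub_eq_zero, eq_comm] using hint

theorem eq_of_populationRank_eq {E : Type*} [NormedAddCommGroup E] [InnerProductSpace ℝ E]
    [FiniteDimensional ℝ E] [MeasurableSpace E] [BorelSpace E] {μ ν : Measure E}
    [IsProbabilityMeasure μ] [IsProbabilityMeasure ν]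
    (h : ∀ p, μ {p} = 0 → ν {p} = 0 → populationRank μ p = populationRank ν p) : μ = ν := by
  have hatoms : ∀ (ρ : Measure E) [IsProbabilityMeasure ρ], {p | 0 < ρ {p}}.Countable :=
    fun ρ _ => Measure.countable_meas_level_set_pos (g := id) measurable_id
  have hcont := (lipschitzWith_normPotential μ).continuous.sub
    (lipschitzWith_normPotential ν).continuous
  have hconst := eq_of_hasFDerivAt_zero_off_countable ((hatoms μ).union (hatoms ν)) hcont
    fun p hp => by
      obtain ⟨hμ, hν⟩ : μ {p} = 0 ∧ ν {p} = 0 := by simpa using hp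
      simpa [h p hμ hν] using (hasGradientAt_normPotential μ hμ).hasFDerivAt.sub
        (hasGradientAt_normPotential ν hν).hasFDerivAt
  refine eq_of_normPotential_eq (funext fun Q => sub_eq_zero.1 ?_)
  simpa using hconst Q 0

section InProbability

variable {ι Ω : Type*} [MeasurableSpace Ω] {l : Filter ι} {P : Measure Ω}

/-- The filter of families of events whose probability tends to one along `l`, so that `∀ᶠ` and
`Tendsto` along it express convergence in probability. It is defined through the complements, in
terms of outer measure, because the events of interest need not be measurable. -/
def inProbability (l : Filter ι) (P : Measure Ω) : Filter (ι × Ω) :=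
  Filter.comk (fun S => Tendsto (fun i => P {ω | (i, ω) ∈ S}) l (𝓝 0))
    (by simpa using tendsto_const_nhds)
    (fun _ hS _ hTS => tendsto_of_tendsto_of_tendsto_of_le_of_le tendsto_const_nhds hS
      (fun _ => zero_le) fun _ => measure_mono fun _ h => hTS h)
    (fun _ hS _ hT => tendsto_of_tendsto_of_tendsto_of_le_of_le tendsto_const_nhds
      (add_zero (0 : ENNReal) ▸ hS.add hT) (fun _ => zero_le) fun _ => measure_union_le _ _)

theorem eventually_inProbability_iff {p : ι × Ω → Prop} :
    (∀ᶠ z in inProbability l P, p z) ↔ Tendsto (fun i => P {ω | ¬ p (i, ω)}) l (𝓝 0) :=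
  Iff.rfl

theorem tendsto_fst_inProbability : Tendsto Prod.fst (inProbability l P) l := by
  intro s hs
  refine eventually_inProbability_iff.2 (tendsto_const_nhds.congr' ?_)
  filter_upwards [hs] with i hi
  simp [hi]

theorem tendsto_measure_one_of_eventually_inProbability [IsProbabilityMeasure P]
    {p : ι × Ω → Prop} (h : ∀ᶠ z in inProbability l P, p z) :
    Tendsto (fun i => P {ω | p (i, ω)}) l (𝓝 1) := by
  have hlower : Tendsto (fun i => 1 - P {ω | ¬ p (i, ω)}) l (𝓝 1) := by
    simpa using ENNReal.Tendsto.sub tendsto_const_nhds (eventually_inProbability_iff.1 h)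
      (Or.inl ENNReal.one_ne_top)
  refine tendsto_of_tendsto_of_tendsto_of_le_of_le hlower tendsto_const_nhds (fun i => ?_)
    fun i => prob_le_one
  rw [tsub_le_iff_right, ← measure_univ (μ := P)]
  exact (measure_mono fun ω _ => em (p (i, ω))).trans (measure_union_le _ _)

theorem tendsto_average_inProbability [IsProbabilityMeasure P] {E : Type*} [MeasurableSpace E]
    {F : Measure E} {X : ℕ → Ω → E} (hX : ∀ j, HasLaw (X j) F P)
    (hind : Pairwise fun i j => IndepFun (X i) (X j) P) {n : ι → ℕ} (hn : Tendsto n l atTop)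
    {h : E → ℝ} (hm : Measurable h) (hint : Integrable h F) :
    Tendsto (fun z : ι × Ω => (∑ j : Fin (n z.1), h (X j z.2)) / (n z.1 : ℝ))
      (inProbability l P) (𝓝 (∫ x, h x ∂F)) := by
  have hmeas : ∀ j, AEStronglyMeasurable (fun ω => h (X j ω)) P := fun j =>
    (hm.comp_aemeasurable (hX j).aemeasurable).aestronglyMeasurable
  have hmeas' : ∀ k : ℕ, AEStronglyMeasurable
      (fun ω => (∑ j ∈ Finset.range k, h (X j ω)) / (k : ℝ)) P := fun k => by
    simpa only [div_eq_mul_inv] using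
      (Finset.aestronglyMeasurable_fun_sum _ fun j _ => hmeas j).mul_const _
  have hslln := strong_law_ae_real (μ := P) (fun j ω => h (X j ω))
    ((hX 0).map_eq ▸ hint |>.comp_aemeasurable (hX 0).aemeasurable)
    (fun i j hij => (hind hij).comp hm hm) (fun j => ((hX j).identDistrib (hX 0)).comp hm)
  have hmean : ∫ ω, h (X 0 ω) ∂P = ∫ x, h x ∂F := (hX 0).integral_comp hm.aestronglyMeasurable
  rw [hmean] at hslln
  have hprob := tendstoInMeasure_iff_dist.1 (tendstoInMeasure_of_tendsto_ae hmeas' hslln)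
  refine Metric.tendsto_nhds.2 fun ε hε => eventually_inProbability_iff.2 ?_
  simpa only [Function.comp_def, not_lt, Finset.sum_range] using (hprob ε hε).comp hn

end InProbability

theorem eventually_exists_of_eventually_prod {κ Y : Type*} {ι : κ → Type*} {L : Filter κ}
    {l : Filter Y} {x : ∀ z, ι z → Y} (hx : ∀ V ∈ l, ∀ᶠ z in L, ∃ k, x z k ∈ V)
    {p : κ × Y → Prop} (hp : ∀ᶠ z in L ×ˢ l, p z) : ∀ᶠ z in L, ∃ k, p (z, x z k) := by
  obtain ⟨a, ha, b, hb, hab⟩ := eventually_prod_iff.1 hp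
  filter_upwards [ha, hx {y | b y} hb] with z hz ⟨k, hk⟩
  exact ⟨k, hab hz hk⟩

theorem tendsto_normPotential_prod_nhds {κ E : Type*} [NormedAddCommGroup E] [MeasurableSpace E]
    [OpensMeasurableSpace E] {L : Filter κ} {μ : κ → Measure E} {F : Measure E}
    [∀ z, IsZeroOrProbabilityMeasure (μ z)]
    (hμ : ∀ Q, Tendsto (fun z => normPotential (μ z) Q) L (𝓝 (normPotential F Q))) (p : E) :
    Tendsto (fun z : κ × E => normPotential (μ z.1) z.2) (L ×ˢ 𝓝 p) (𝓝 (normPotential F p)) := by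
  have hmove : Tendsto (fun z : κ × E => normPotential (μ z.1) z.2 - normPotential (μ z.1) p)
      (L ×ˢ 𝓝 p) (𝓝 0) :=
    squeeze_zero_norm (fun z => abs_normPotential_sub_le (μ z.1) z.2 p)
      ((tendsto_iff_norm_sub_tendsto_zero.1 tendsto_id).comp tendsto_snd)
  simpa using hmove.add ((hμ p).comp tendsto_fst)

section Empirical

variable {d : ℕ}

section Population

variable (μ : Measure (EuclideanSpace ℝ (Fin d))) [IsProbabilityMeasure μ]
  (u q : EuclideanSpace ℝ (Fin d))

theorem quantileObjective_eq :
    quantileObjective μ u q = normPotential μ q - inner ℝ u q := by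
  have hloss : ∀ x, quantileLoss u (x - q) - quantileLoss u x = (‖x - q‖ - ‖x‖) - inner ℝ u q := by
    intro x
    rw [quantileLoss, quantileLoss, inner_sub_right]
    ring
  simp_rw [quantileObjective, hloss]
  rw [integral_sub (integrable_norm_sub_sub_norm μ q) (integrable_const _)]
  simp [normPotential]

theorem isSpatialQuantile_iff_hasSubgradientAt :
    IsSpatialQuantile μ u q ↔ HasSubgradientAt (normPotential μ) u q := by
  simp only [IsSpatialQuantile, quantileObjective_eq, hasSubgradientAt_iff_forall_sub_inner_le]

end Population

theorem hasSubgradientAt_spatialQuantile {μ : Measure (EuclideanSpace ℝ (Fin d))}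
    [IsProbabilityMeasure μ] {u : EuclideanSpace ℝ (Fin d)}
    (h : ∃ q, HasSubgradientAt (normPotential μ) u q) :
    HasSubgradientAt (normPotential μ) u (spatialQuantile μ u) := by
  simp only [← isSpatialQuantile_iff_hasSubgradientAt] at h ⊢
  exact Classical.epsilon_spec h

theorem isProbabilityMeasure_empiricalDistribution {n : ℕ} (hn : n ≠ 0)
    (x : Fin n → EuclideanSpace ℝ (Fin d)) : IsProbabilityMeasure (empiricalDistribution x) := by
  constructor
  simp [empiricalDistribution, ENNReal.inv_mul_cancel (Nat.cast_ne_zero.2 hn)]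

instance isZeroOrProbabilityMeasure_empiricalDistribution {n : ℕ}
    (x : Fin n → EuclideanSpace ℝ (Fin d)) :
    IsZeroOrProbabilityMeasure (empiricalDistribution x) := by
  rcases eq_or_ne n 0 with rfl | hn
  · exact ⟨Or.inl (by simp [empiricalDistribution])⟩
  · have := isProbabilityMeasure_empiricalDistribution hn x
    infer_instance

theorem integral_empiricalDistribution {V : Type*} [NormedAddCommGroup V] [NormedSpace ℝ V]
    [CompleteSpace V] {n : ℕ} (x : Fin n → EuclideanSpace ℝ (Fin d))
    (f : EuclideanSpace ℝ (Fin d) → V) :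
    ∫ y, f y ∂empiricalDistribution x = (n : ℝ)⁻¹ • ∑ i, f (x i) := by
  rw [empiricalDistribution, integral_smul_measure,
    integral_finsetSum_measure fun i _ => integrable_dirac enorm_lt_top]
  simp

theorem populationRank_empiricalDistribution {n : ℕ} (x : Fin n → EuclideanSpace ℝ (Fin d))
    (z : EuclideanSpace ℝ (Fin d)) :
    populationRank (empiricalDistribution x) z = spatialRank x z := by
  rw [populationRank, integral_empiricalDistribution, spatialRank, Finset.sum_filter_of_ne]
  rintro i - hi rfl
  simp at hi

end Empirical

section Consistency

variable {d : ℕ} {κ : Type*} {L : Filter κ} {n m : κ → ℕ}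
  {x : ∀ z, Fin (n z) → EuclideanSpace ℝ (Fin d)} {y : ∀ z, Fin (m z) → EuclideanSpace ℝ (Fin d)}
  {F G : Measure (EuclideanSpace ℝ (Fin d))}

theorem tendsto_empiricalSpatialQuantile [IsFiniteMeasure F] [F.IsOpenPosMeasure]
    (hn : ∀ᶠ z in L, n z ≠ 0)
    (hx : ∀ Q, Tendsto (fun z => normPotential (empiricalDistribution (x z)) Q) L
      (𝓝 (normPotential F Q)))
    {u q : EuclideanSpace ℝ (Fin d)} (hq : HasSubgradientAt (normPotential F) u q) :
    Tendsto (fun z : κ × EuclideanSpace ℝ (Fin d) => empiricalSpatialQuantile (x z.1) z.2)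
      (L ×ˢ 𝓝 u) (𝓝 q) := by
  refine Metric.tendsto_nhds.2 fun ε hε => ?_
  filter_upwards [hn.prod_inl (𝓝 u), eventually_hasSubgradientAt_near
    (fun z => convexOn_normPotential (empiricalDistribution (x z)))
    (tendsto_normPotential_prod_nhds hx) (strictConvexOn_normPotential F) hq hε]
    with z hnz ⟨hexists, hnear⟩
  have := isProbabilityMeasure_empiricalDistribution hnz (x z.1)
  rw [dist_eq_norm]
  exact hnear _ (hasSubgradientAt_spatialQuantile hexists)

theorem tendsto_spatialRank [IsFiniteMeasure F]
    (hx : ∀ Q, Tendsto (fun z => normPotential (empiricalDistribution (x z)) Q) L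
      (𝓝 (normPotential F Q)))
    {p : EuclideanSpace ℝ (Fin d)} (hp : F {p} = 0) :
    Tendsto (fun z : κ × EuclideanSpace ℝ (Fin d) => spatialRank (x z.1) z.2)
      (L ×ˢ 𝓝 p) (𝓝 (populationRank F p)) := by
  refine Metric.tendsto_nhds.2 fun η hη => ?_
  filter_upwards [eventually_subgradient_near
    (g := fun z => normPotential (empiricalDistribution (x z))) (tendsto_normPotential_prod_nhds hx)
    (hasGradientAt_normPotential F hp) hη] with z hz
  rw [dist_eq_norm, ← populationRank_empiricalDistribution]
  exact hz _ (hasSubgradientAt_populationRank _ _)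

theorem mem_lineNeighborhood_of_abs_sub_lt {a b ε : ℝ} (h : |b - a| < ε) :
    !₂[a, b] ∈ lineNeighborhood ε := by
  refine Metric.mem_thickening_iff.2 ⟨!₂[a, a], by simp, ?_⟩
  rw [EuclideanSpace.dist_eq]
  simpa [Real.sqrt_sq_eq_abs, Real.dist_eq] using h

theorem abs_sub_lt_of_mem_lineNeighborhood {a b ε : ℝ} (h : !₂[a, b] ∈ lineNeighborhood ε) :
    |b - a| < 2 * ε := by
  obtain ⟨p, hp, hdist⟩ := Metric.mem_thickening_iff.1 h
  rw [dist_eq_norm] at hdist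
  have hcoord : ∀ i, |(!₂[a, b] - p) i| < ε := fun i =>
    (PiLp.norm_apply_le (!₂[a, b] - p) i).trans_lt hdist
  have hdiff : b - a = (!₂[a, b] - p) 1 - (!₂[a, b] - p) 0 := by simp [hp.out]
  rw [hdiff]
  linarith [abs_sub ((!₂[a, b] - p) 1) ((!₂[a, b] - p) 0), hcoord 0, hcoord 1]

theorem eventually_forall_qqPlot_subset_lineNeighborhood [IsProbabilityMeasure F]
    [F.IsOpenPosMeasure]
    (hn : ∀ᶠ z in L, n z ≠ 0) (hm : ∀ᶠ z in L, m z ≠ 0)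
    (hx : ∀ Q, Tendsto (fun z => normPotential (empiricalDistribution (x z)) Q) L
      (𝓝 (normPotential F Q)))
    (hy : ∀ Q, Tendsto (fun z => normPotential (empiricalDistribution (y z)) Q) L
      (𝓝 (normPotential F Q)))
    {r : ℝ} (hr : r < 1) {ε : ℝ} (hε : 0 < ε) :
    ∀ᶠ z in L, ∀ i, qqPlot r (x z) (y z) i ⊆ lineNeighborhood ε := by
  have hclose : ∀ᶠ z in L, ∀ u ∈ Metric.closedBall (0 : EuclideanSpace ℝ (Fin d)) r,
      ‖empiricalSpatialQuantile (y z) u - empiricalSpatialQuantile (x z) u‖ < ε := by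
    refine eventually_forall_mem_of_isCompact (isCompact_closedBall _ _) fun u hu => ?_
    obtain ⟨q, hq⟩ := exists_hasSubgradientAt_normPotential F
      ((mem_closedBall_zero_iff.1 hu).trans_lt hr)
    have hdiff := (tendsto_empiricalSpatialQuantile hm hy hq).sub
      (tendsto_empiricalSpatialQuantile hn hx hq)
    rw [sub_self] at hdiff
    exact hdiff.norm.eventually_lt_const (by simpa using hε)
  filter_upwards [hclose] with z hz i
  rintro _ ⟨k, hk, rfl⟩
  exact mem_lineNeighborhood_of_abs_sub_lt ((PiLp.norm_apply_le _ i).trans_lt (hz _ hk))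

theorem eventually_not_forall_qqPlot_subset_lineNeighborhood [IsFiniteMeasure F]
    [F.IsOpenPosMeasure] [IsFiniteMeasure G] [G.IsOpenPosMeasure]
    (hn : ∀ᶠ z in L, n z ≠ 0) (hm : ∀ᶠ z in L, m z ≠ 0)
    (hx : ∀ Q, Tendsto (fun z => normPotential (empiricalDistribution (x z)) Q) L
      (𝓝 (normPotential F Q)))
    (hy : ∀ Q, Tendsto (fun z => normPotential (empiricalDistribution (y z)) Q) L
      (𝓝 (normPotential G Q)))
    {p q : EuclideanSpace ℝ (Fin d)} (hp : F {p} = 0)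
    (hxp : ∀ U ∈ 𝓝 p, ∀ᶠ z in L, ∃ k, x z k ∈ U)
    (hq : HasSubgradientAt (normPotential G) (populationRank F p) q)
    {r : ℝ} (hr : ‖populationRank F p‖ < r) {ε : ℝ} {i : Fin d} (hε : 2 * ε < |q i - p i|) :
    ∀ᶠ z in L, ¬ ∀ i, qqPlot r (x z) (y z) i ⊆ lineNeighborhood ε := by
  have hcoord : ∀ {f : κ × EuclideanSpace ℝ (Fin d) → EuclideanSpace ℝ (Fin d)} {c l},
      Tendsto f l (𝓝 c) → Tendsto (fun z => f z i) l (𝓝 (c i)) := fun h =>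
    ((EuclideanSpace.proj (𝕜 := ℝ) i).continuous.tendsto _).comp h
  have hdiff := (hcoord (tendsto_empiricalSpatialQuantile hm hy hq)).sub
    (hcoord (tendsto_empiricalSpatialQuantile hn hx (hasSubgradientAt_populationRank F p)))
  have hlevel : ∀ᶠ z in L ×ˢ 𝓝 (populationRank F p), ‖z.2‖ < r ∧
      2 * ε < |empiricalSpatialQuantile (y z.1) z.2 i - empiricalSpatialQuantile (x z.1) z.2 i| :=
    (tendsto_snd.norm.eventually_lt_const hr).and (hdiff.abs.eventually_const_lt hε)
  have hrank : ∀ V ∈ 𝓝 (populationRank F p), ∀ᶠ z in L, ∃ k, spatialRank (x z) (x z k) ∈ V :=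
    fun V hV => eventually_exists_of_eventually_prod (p := fun z => spatialRank (x z.1) z.2 ∈ V) hxp
      (tendsto_spatialRank hx hp hV)
  filter_upwards [eventually_exists_of_eventually_prod hrank hlevel] with z ⟨k, hkr, hkε⟩ hall
  exact (abs_sub_lt_of_mem_lineNeighborhood
    (hall i ⟨Sum.inl k, mem_closedBall_zero_iff.2 hkr.le, rfl⟩)).not_gt hkε

end Consistency

theorem exists_hasSubgradientAt_populationRank_ne {E : Type*} [NormedAddCommGroup E]
    [InnerProductSpace ℝ E] [FiniteDimensional ℝ E] [MeasurableSpace E] [BorelSpace E]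
    {μ ν : Measure E} [IsProbabilityMeasure μ] [IsProbabilityMeasure ν] [μ.IsOpenPosMeasure]
    (hne : μ ≠ ν) :
    ∃ p q, μ {p} = 0 ∧ HasSubgradientAt (normPotential ν) (populationRank μ p) q ∧ p ≠ q := by
  obtain ⟨p, hμ, hν, hrank⟩ : ∃ p, μ {p} = 0 ∧ ν {p} = 0 ∧
      populationRank μ p ≠ populationRank ν p := by
    by_contra! hall
    exact hne (eq_of_populationRank_eq hall)
  obtain ⟨q, hq⟩ := exists_hasSubgradientAt_normPotential ν
    (hasSubgradientAt_populationRank μ p).norm_lt_one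
  refine ⟨p, q, hμ, hq, ?_⟩
  rintro rfl
  exact hrank ((hq.hasGradientAt (differentiableAt_normPotential ν hν)).unique
    (hasGradientAt_normPotential ν hν))

section Sample

variable {ι Ω : Type*} [MeasurableSpace Ω] {P : Measure Ω} [IsProbabilityMeasure P]
  {d : ℕ} {F : Measure (EuclideanSpace ℝ (Fin d))} {X : ℕ → Ω → EuclideanSpace ℝ (Fin d)}
  {l : Filter ι} {n : ι → ℕ}

theorem eventually_sampleSize_ne_zero (P : Measure Ω) (hn : Tendsto n l atTop) :
    ∀ᶠ z in inProbability l P, n z.1 ≠ 0 :=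
  tendsto_fst_inProbability.eventually (p := fun i => n i ≠ 0) (hn.eventually_ne_atTop 0)

theorem tendsto_normPotential_empiricalDistribution [IsFiniteMeasure F]
    (hX : ∀ j, HasLaw (X j) F P) (hind : Pairwise fun i j => IndepFun (X i) (X j) P)
    (hn : Tendsto n l atTop) (Q : EuclideanSpace ℝ (Fin d)) :
    Tendsto (fun z : ι × Ω =>
        normPotential (empiricalDistribution fun j : Fin (n z.1) => X j z.2) Q)
      (inProbability l P) (𝓝 (normPotential F Q)) := by
  simp_rw [normPotential, integral_empiricalDistribution, smul_eq_mul, inv_mul_eq_div]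
  exact tendsto_average_inProbability hX hind hn (h := fun x => ‖x - Q‖ - ‖x‖)
    (Continuous.measurable (by fun_prop)) (integrable_norm_sub_sub_norm F Q)

theorem eventually_exists_sample_mem {E : Type*} [TopologicalSpace E] [MeasurableSpace E]
    [OpensMeasurableSpace E] {F : Measure E} [IsFiniteMeasure F] [F.IsOpenPosMeasure]
    {X : ℕ → Ω → E} (hX : ∀ j, HasLaw (X j) F P)
    (hind : Pairwise fun i j => IndepFun (X i) (X j) P) (hn : Tendsto n l atTop) {p : E}
    {U : Set E} (hU : U ∈ 𝓝 p) :
    ∀ᶠ z in inProbability l P, ∃ k : Fin (n z.1), X k z.2 ∈ U := by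
  have hmeas : MeasurableSet (interior U) := isOpen_interior.measurableSet
  have hlim := tendsto_average_inProbability hX hind hn (h := (interior U).indicator 1)
    (measurable_one.indicator hmeas) ((integrable_const 1).indicator hmeas)
  rw [integral_indicator_one hmeas] at hlim
  have hpos : 0 < F.real (interior U) := ENNReal.toReal_pos
    (isOpen_interior.measure_pos F ⟨p, mem_interior_iff_mem_nhds.2 hU⟩).ne' (measure_ne_top _ _)
  filter_upwards [hlim.eventually_const_lt hpos] with z hz
  by_contra! hnone
  refine hz.ne' ?_
  rw [Finset.sum_eq_zero, zero_div]
  exact fun k _ => Set.indicator_of_notMem (fun hk => hnone k (interior_subset hk)) _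

end Sample

theorem HasPositiveLocallyBoundedDensity.isOpenPosMeasure {d : ℕ}
    {F : Measure (EuclideanSpace ℝ (Fin d))} (hF : HasPositiveLocallyBoundedDensity F) :
    F.IsOpenPosMeasure := by
  obtain ⟨f, hf, hpos, -, rfl⟩ := hF
  exact (withDensity_absolutelyContinuous' hf.ennreal_ofReal.aemeasurable
    (Eventually.of_forall fun x => by simpa using hpos x)).isOpenPosMeasure

theorem theorem2p2_general {d : ℕ}
    (F G : Measure (EuclideanSpace ℝ (Fin d)))
    [IsProbabilityMeasure F] [IsProbabilityMeasure G] [F.IsOpenPosMeasure] [G.IsOpenPosMeasure]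
    {Ω : Type*} [MeasurableSpace Ω] (P : Measure Ω) [IsProbabilityMeasure P]
    (X Y : ℕ → Ω → EuclideanSpace ℝ (Fin d))
    (hX : ∀ j, HasLaw (X j) F P) (hY : ∀ j, HasLaw (Y j) G P)
    (hindX : Pairwise fun i j => IndepFun (X i) (X j) P)
    (hindY : Pairwise fun i j => IndepFun (Y i) (Y j) P)
    (n m : ℕ → ℕ) (hn : Tendsto n atTop atTop) (hm : Tendsto m atTop atTop) :
    (∀ r ∈ Set.Ioo (0 : ℝ) 1, ∀ ε > 0,
      Tendsto (fun N => P (⋂ i : Fin d,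
          {ω | qqPlot r (fun j : Fin (n N) => X j ω) (fun j : Fin (m N) => Y j ω) i
            ⊆ lineNeighborhood ε}))
        atTop (𝓝 1)) ↔ F = G := by
  have hn0 := eventually_sampleSize_ne_zero P hn
  have hm0 := eventually_sampleSize_ne_zero P hm
  have hXpot := tendsto_normPotential_empiricalDistribution hX hindX hn
  have hYpot := tendsto_normPotential_empiricalDistribution hY hindY hm
  simp only [← Set.ofPred_forall]
  constructor
  · contrapose!
    intro hne
    obtain ⟨p, q, hp, hq, hpq⟩ := exists_hasSubgradientAt_populationRank_ne hne
    obtain ⟨r, hur, hr⟩ := exists_between (hasSubgradientAt_populationRank F p).norm_lt_one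
    obtain ⟨i, hi⟩ : ∃ i, p i ≠ q i := by
      by_contra! hall
      exact hpq (PiLp.ext hall)
    have hgap : 0 < |q i - p i| := abs_pos.2 (sub_ne_zero.2 hi.symm)
    have hoff := eventually_not_forall_qqPlot_subset_lineNeighborhood hn0 hm0 hXpot hYpot hp
      (fun U hU => eventually_exists_sample_mem hX hindX hn hU) hq hur
      (i := i) (ε := |q i - p i| / 4) (by linarith)
    have hzero := eventually_inProbability_iff.1 hoff
    simp only [not_not] at hzero
    exact ⟨r, ⟨(norm_nonneg _).trans_lt hur, hr⟩, _, by positivity, fun hone =>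
      one_ne_zero (tendsto_nhds_unique hone hzero)⟩
  · rintro rfl r hr ε hε
    exact tendsto_measure_one_of_eventually_inProbability
      (eventually_forall_qqPlot_subset_lineNeighborhood hn0 hm0 hXpot hYpot hr.2 hε)

theorem theorem2p2 {d : ℕ} (hd : 2 ≤ d)
    (F G : Measure (EuclideanSpace ℝ (Fin d)))
    [IsProbabilityMeasure F] [IsProbabilityMeasure G]
    (hF : HasPositiveLocallyBoundedDensity F) (hG : HasPositiveLocallyBoundedDensity G)
    {Ω : Type*} [MeasurableSpace Ω] (P : Measure Ω) [IsProbabilityMeasure P]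
    (X Y : ℕ → Ω → EuclideanSpace ℝ (Fin d))
    (hX : ∀ j, HasLaw (X j) F P) (hY : ∀ j, HasLaw (Y j) G P)
    (hindep : iIndepFun (Sum.elim X Y) P)
    (n m : ℕ → ℕ) (hn : Tendsto n atTop atTop) (hm : Tendsto m atTop atTop)
    (lam : ℝ) (hlam : lam ∈ Set.Ioo (0 : ℝ) 1)
    (hnm : Tendsto (fun N => (n N : ℝ) / ((n N : ℝ) + (m N : ℝ))) atTop (𝓝 lam)) :
    (∀ r ∈ Set.Ioo (0 : ℝ) 1, ∀ ε > 0,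
      Tendsto (fun N => P (⋂ i : Fin d,
          {ω | qqPlot r (fun j : Fin (n N) => X j ω) (fun j : Fin (m N) => Y j ω) i
            ⊆ lineNeighborhood ε}))
        atTop (𝓝 1)) ↔ F = G := by
  have := hF.isOpenPosMeasure
  have := hG.isOpenPosMeasure
  exact theorem2p2_general F G P X Y hX hY
    (fun i j hij => hindep.indepFun (i := Sum.inl i) (j := Sum.inl j) (by simpa using hij))
    (fun i j hij => hindep.indepFun (i := Sum.inr i) (j := Sum.inr j) (by simpa using hij))
    n m hn hm
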